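/- Let $L\ge 1$ be an integer and let $\kappa=l/2$ with $l$ an odd positive integer. Put $\theta(\tau)=\sum_{n\in\mathbb Z}e^{2\pi i n^2\tau}$ for $\tau$ in the upper half plane $\mathbb H$, and $j(\gamma,\tau)=\theta(\gamma\tau)/\theta(\tau)$ for $\gamma\in\Gamma_0(4)$. Let $S_\kappa(\Gamma_1(4L))$ be the space of holomorphic functions $f:\mathbb H\to\mathbb C$ with $f(\gamma\tau)=j(\gamma,\tau)^{l}f(\tau)$ for all $\gamma\in\Gamma_1(4L)$ that vanish at all cusps, i.e. $(c\tau+d)^{-\kappa}f(\gamma\tau)\to 0$ as $\operatorname{Im}\tau\to\infty$ for every $\gamma=\begin{pmatrix}a&b\\c&d\end{pmatrix}\in\mathrm{SL}_2(\mathbb Z)$. For such $f$ write $f(\tau)=\sum_{n\ge 1}a(f,n)e^{2\pi i n\tau}$. Lemma. Let $h\in S_\kappa(\Gamma_1(4L))$ be non-zero and let $p$ be an odd prime dividing $L$. If $a(h,n)=0$ for all $n$ coprime to $p$, then the function $g(\tau):=h(\tau/p)$ belongs to $S_\kappa(\Gamma_1(4L/p))$. -/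

import Mathlib

open scoped UpperHalfPlane MatrixGroups Manifold

noncomputable section

namespace HalfIntegralWeight

open UpperHalfPlane

/-- The standard theta function `θ(τ) = ∑_{n ∈ ℤ} e^{2πi n² τ}` on the upper half plane,
expressed through the Jacobi theta function `jacobiTheta z = ∑_{n ∈ ℤ} e^{πi n² z}`. -/
def theta (τ : ℍ) : ℂ := jacobiTheta (2 * (τ : ℂ))

/-- The theta automorphy factor `j(γ, τ) = θ(γτ) / θ(τ)`, which for `γ = (a, b; c, d) ∈ Γ₀(4)` is
the usual automorphy factor `ε_d⁻¹ (c/d) (cτ + d)^{1/2}` of weight `1/2`. -/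
def thetaFactor (γ : SL(2, ℤ)) (τ : ℍ) : ℂ := theta (γ • τ) / theta τ

/-- `f` is a cusp form of weight `l / 2` on `Γ₁(4L)`. -/
structure IsCuspForm (l L : ℕ) (f : ℍ → ℂ) : Prop where
  holo : MDifferentiable 𝓘(ℂ) 𝓘(ℂ) f
  transform : ∀ γ ∈ CongruenceSubgroup.Gamma1 (4 * L), ∀ τ : ℍ,
    f (γ • τ) = thetaFactor γ τ ^ l * f τ
  /-- Vanishing at every cusp: for each `γ = (a, b; c, d) ∈ SL₂(ℤ)` the function
  `(cτ + d)^{-l/2} f(γτ)` tends to `0` as `Im τ → ∞`. (Which branch of the square root is used is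
  irrelevant for this.) -/
  zero_at_cusps : ∀ γ : SL(2, ℤ),
    IsZeroAtImInfty fun τ : ℍ ↦ denom γ τ ^ (-((l : ℂ) / 2)) * f (γ • τ)

/-- The complex vector space `S_{l/2}(Γ₁(4L))` of cusp forms of weight `l / 2` (`l` odd) on
`Γ₁(4L)`. -/
def cuspForms (l L : ℕ) : Submodule ℂ (ℍ → ℂ) where
  carrier := {f | IsCuspForm l L f}
  zero_mem' :=
    { holo := mdifferentiable_const
      transform := fun _ _ _ ↦ by simp
      zero_at_cusps := fun γ ↦ by
        simp [IsZeroAtImInfty, Filter.ZeroAtFilter] }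
  add_mem' {f g} hf hg :=
    { holo := hf.holo.add hg.holo
      transform := fun γ hγ τ ↦ by
        simp only [Pi.add_apply, hf.transform γ hγ τ, hg.transform γ hγ τ, mul_add]
      zero_at_cusps := fun γ ↦ by
        simpa [IsZeroAtImInfty, Filter.ZeroAtFilter, mul_add] using
          Filter.Tendsto.add (hf.zero_at_cusps γ) (hg.zero_at_cusps γ) }
  smul_mem' c f hf :=
    { holo := hf.holo.const_smul c
      transform := fun γ hγ τ ↦ by
        simp only [Pi.smul_apply, smul_eq_mul, hf.transform γ hγ τ]
        ring
      zero_at_cusps := fun γ ↦ by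
        simpa [IsZeroAtImInfty, Filter.ZeroAtFilter, mul_left_comm] using
          Filter.Tendsto.const_mul c (hf.zero_at_cusps γ) }

/-- The Fourier coefficient `a(f, n)` of a 1-periodic function `f(τ) = ∑ a(f, n) e^{2πi n τ}`. -/
def fourierCoeff (f : ℍ → ℂ) (n : ℕ) : ℂ := (qExpansion 1 f).coeff n

/-- The point `τ / p` of the upper half plane, for a positive integer `p`. -/
def divNat (p : ℕ) (hp : 0 < p) (τ : ℍ) : ℍ :=
  ⟨(τ : ℂ) / (p : ℂ), by
    rw [Complex.div_natCast_im]
    exact div_pos τ.im_pos (Nat.cast_pos.mpr hp)⟩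

end HalfIntegralWeight

end

namespace HalfIntegralWeight

open UpperHalfPlane hiding I re im
open Filter Topology

/-! ### Non-vanishing of the theta function -/

section Nonvanishing

open Complex Real

/-! Write L = pM and g(τ) = h(τ/p). Only exponents divisible by p occur in h, so g is invariant
under `T`. If γ = (a, b; c, d) has p ∣ b, 4M ∣ c and a ≡ d ≡ 1 mod 4pM, then conjugation by diag(1,
p) gives δ = (a, b/p; pc, d) in Γ₁(4pM), and g(γτ) = h(δ(τ/p)). The factors j(δ, τ/p) and j(γ, τ)
share the square root of cτ + d and differ only by the symbol (p/|d|), which is 1 because d ≡ 1 mod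
4p (`mem_transformSubgroup_of_dvd`). Such γ together with `T` generate Γ₁(4M)
(`Gamma1_le_transformSubgroup`).

Comparing the factors needs the explicit theta multiplier on Γ₁(4), `thetaLaw_of_mem_Gamma1_four`,
proved by descent on the bottom row. It also needs θ to have no zeros (`theta_ne_zero`): only then
is the quotient θ(γτ)/θ(τ) a genuine cocycle. At the cusps, diag(1, p)γ factors as an element of
SL₂(ℤ) times an upper triangular matrix, which reduces the claim to the cusps of h
(`IsCuspForm.divNat_zero_at_cusps`). -/

lemma exp_pi_mul_I_mul_even (m : ℤ) (hm : Even m) : cexp (π * I * m) = 1 := by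
  obtain ⟨k, rfl⟩ := hm
  rw [← Complex.exp_int_mul_two_pi_mul_I k]
  push_cast
  ring_nf

lemma jacobiTheta₂_zero_add_one (τ : ℂ) :
    jacobiTheta₂ 0 (τ + 1) = jacobiTheta₂ (1 / 2) τ := by
  refine tsum_congr fun n ↦ ?_
  have h := exp_pi_mul_I_mul_even (n * (n - 1)) (Int.even_mul_pred_self n)
  calc jacobiTheta₂_term n _ (τ + 1)
      = jacobiTheta₂_term n (1 / 2) τ * cexp (π * I * (n * (n - 1) : ℤ)) := by
        rw [jacobiTheta₂_term, jacobiTheta₂_term, ← Complex.exp_add]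
        push_cast
        ring_nf
    _ = _ := by rw [h, mul_one]

lemma jacobiTheta₂_half_add_one (τ : ℂ) :
    jacobiTheta₂ (1 / 2) (τ + 1) = jacobiTheta₂ 0 τ := by
  rw [← jacobiTheta₂_zero_add_one, add_assoc, one_add_one_eq_two, jacobiTheta₂_add_right]

lemma jacobiTheta₂_half_tau_add_one (τ : ℂ) :
    jacobiTheta₂ ((τ + 1) / 2) (τ + 1) = jacobiTheta₂ (τ / 2) τ := by
  refine tsum_congr fun n ↦ ?_
  have h := exp_pi_mul_I_mul_even (n * (n + 1)) (Int.even_mul_succ_self n)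
  calc jacobiTheta₂_term n _ (τ + 1)
      = jacobiTheta₂_term n (τ / 2) τ * cexp (π * I * (n * (n + 1) : ℤ)) := by
        rw [jacobiTheta₂_term, jacobiTheta₂_term, ← Complex.exp_add]
        push_cast
        ring_nf
    _ = _ := by rw [h, mul_one]

lemma jacobiTheta₂_div_neg_inv_eq_zero_iff (z : ℂ) (τ : ℍ) :
    jacobiTheta₂ (z / τ) (-1 / τ) = 0 ↔ jacobiTheta₂ z τ = 0 := by
  rw [jacobiTheta₂_functional_equation z τ]
  have h : (-I * (τ : ℂ)) ^ (1 / 2 : ℂ) ≠ 0 := by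
    rw [Ne, cpow_eq_zero_iff, not_and_or]
    exact Or.inl (mul_ne_zero (neg_ne_zero.mpr I_ne_zero) τ.ne_zero)
  simp only [mul_eq_zero, div_eq_zero_iff, one_ne_zero, h, Complex.exp_ne_zero, or_self, false_or]

/-- The three theta constants `θ₂`, `θ₃`, `θ₄` are all non-zero at `τ` (for `θ₂`, the factor
`e^{πiτ/4}` is omitted). -/
def ThetaConstantsNeZero (τ : ℍ) : Prop :=
  jacobiTheta₂ 0 τ ≠ 0 ∧ jacobiTheta₂ (1 / 2) τ ≠ 0 ∧ jacobiTheta₂ (τ / 2) τ ≠ 0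

lemma thetaConstantsNeZero_T_smul (τ : ℍ) :
    ThetaConstantsNeZero (ModularGroup.T • τ) ↔ ThetaConstantsNeZero τ := by
  have h : ((ModularGroup.T • τ : ℍ) : ℂ) = τ + 1 := by
    rw [modular_T_smul, coe_vadd, ofReal_one, add_comm]
  simp only [ThetaConstantsNeZero, h, jacobiTheta₂_zero_add_one, jacobiTheta₂_half_add_one,
    jacobiTheta₂_half_tau_add_one]
  tauto

lemma thetaConstantsNeZero_S_smul (τ : ℍ) :
    ThetaConstantsNeZero (ModularGroup.S • τ) ↔ ThetaConstantsNeZero τ := by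
  have h : ((ModularGroup.S • τ : ℍ) : ℂ) = -1 / τ := by
    rw [modular_S_smul]
    simp [neg_div]
  have h3 := jacobiTheta₂_div_neg_inv_eq_zero_iff 0 τ
  have h2 := jacobiTheta₂_div_neg_inv_eq_zero_iff (1 / 2) τ
  have h4 := jacobiTheta₂_div_neg_inv_eq_zero_iff (-(τ / 2)) τ
  rw [zero_div] at h3
  rw [jacobiTheta₂_neg_left, show -((τ : ℂ) / 2) / τ = -(1 / 2) by field_simp [τ.ne_zero],
    jacobiTheta₂_neg_left] at h4
  rw [show (1 / 2 : ℂ) / τ = -(-1 / τ / 2) by ring, jacobiTheta₂_neg_left] at h2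
  simp only [ThetaConstantsNeZero, h, Ne, h3, h2, h4]
  tauto

/-- Up to non-zero factors, `T` swaps θ₃ and θ₄ while `S` swaps θ₂ and θ₄. A single theta constant
is not preserved by the full modular group, which is why all three are treated together. -/
lemma thetaConstantsNeZero_smul (γ : SL(2, ℤ)) (τ : ℍ) :
    ThetaConstantsNeZero (γ • τ) ↔ ThetaConstantsNeZero τ := by
  have hγ : γ ∈ Subgroup.closure {ModularGroup.S, ModularGroup.T} := by
    simp [SpecialLinearGroup.SL2Z_generators]
  induction hγ using Subgroup.closure_induction generalizing τ with
  | mem x hx =>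
    rcases hx with rfl | rfl
    · exact thetaConstantsNeZero_S_smul τ
    · exact thetaConstantsNeZero_T_smul τ
  | one => rw [one_smul]
  | mul x y _ _ hx hy => exact (mul_smul x y τ).symm ▸ (hx (y • τ)).trans (hy τ)
  | inv x _ hx => exact (smul_inv_smul x τ ▸ hx (x⁻¹ • τ)).symm

/-- The bound 1/3 is the threshold below which 2r/(1 - r) < 1, so that the leading term of each
theta series dominates its tail. -/
lemma exp_neg_pi_mul_lt {y : ℝ} (hy : 1 / 2 ≤ y) : rexp (-π * y) < 1 / 3 := by
  have h1 : rexp (-π * y) ≤ rexp (-1.5) := by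
    apply Real.exp_le_exp.mpr
    nlinarith [Real.pi_gt_three]
  have h2 : rexp (-1.5) < 1 / 3 := by
    rw [Real.exp_neg, ← one_div, one_div_lt_one_div (Real.exp_pos _) (by norm_num)]
    have h3 : (2.7 : ℝ) < rexp 1 := by linarith [Real.exp_one_gt_d9]
    have h4 : rexp 1.5 ^ 2 = rexp 1 ^ 3 := by
      rw [← Real.exp_nat_mul, ← Real.exp_nat_mul]
      norm_num
    have h5 : (2.7 : ℝ) ^ 3 < rexp 1 ^ 3 := by gcongr
    refine lt_of_pow_lt_pow_left₀ 2 (Real.exp_pos _).le ?_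
    rw [h4]
    norm_num at h5 ⊢
    linarith
  linarith

lemma jacobiTheta_ne_zero_of_half_le_im {τ : ℂ} (hτ : 1 / 2 ≤ τ.im) : jacobiTheta τ ≠ 0 := by
  intro h0
  have h := norm_jacobiTheta_sub_one_le (show 0 < τ.im by linarith)
  rw [h0, zero_sub, norm_neg, norm_one] at h
  have hx := exp_neg_pi_mul_lt hτ
  rw [div_mul_eq_mul_div, le_div_iff₀ (by linarith)] at h
  linarith

lemma jacobiTheta₂_half_tau_ne_zero_of_half_le_im {τ : ℂ} (hτ : 1 / 2 ≤ τ.im) :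
    jacobiTheta₂ (τ / 2) τ ≠ 0 := by
  have hτ0 : 0 < τ.im := by linarith
  have hterm (n : ℤ) : jacobiTheta₂_term n (τ / 2) τ = cexp (π * I * (n * (n + 1)) * τ) := by
    rw [jacobiTheta₂_term]
    ring_nf
  have hs := (hasSum_jacobiTheta₂_term (τ / 2) hτ0).summable
  have hs1 : Summable fun n : ℕ ↦ jacobiTheta₂_term n (τ / 2) τ :=
    hs.comp_injective Nat.cast_injective
  -- The exponent n(n + 1) is symmetric under n ↦ -(n + 1), so the series is twice its half over n ≥
  -- 0.
  have hsymm (n : ℕ) : jacobiTheta₂_term (-(n + 1 : ℤ)) (τ / 2) τ =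
      jacobiTheta₂_term n (τ / 2) τ := by
    rw [hterm, hterm]
    push_cast
    ring_nf
  have hsum : jacobiTheta₂ (τ / 2) τ = 2 * ∑' n : ℕ, jacobiTheta₂_term n (τ / 2) τ := by
    have hs2 : Summable fun n : ℕ ↦ jacobiTheta₂_term (-(n + 1 : ℤ)) (τ / 2) τ :=
      hs1.congr fun n ↦ (hsymm n).symm
    rw [jacobiTheta₂, tsum_of_nat_of_neg_add_one
        (f := fun n : ℤ ↦ jacobiTheta₂_term n (τ / 2) τ) hs1 hs2, tsum_congr hsymm, two_mul]
  set r := rexp (-π * τ.im) with hr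
  have hr3 : r < 1 / 3 := exp_neg_pi_mul_lt hτ
  have hr0 : 0 < r := Real.exp_pos _
  have hbound (n : ℕ) : ‖jacobiTheta₂_term (n + 1 : ℕ) (τ / 2) τ‖ ≤ r ^ (n + 1) := by
    rw [hterm, Complex.norm_exp, hr, ← Real.exp_nat_mul]
    apply Real.exp_le_exp.mpr
    have : (π * I * (((n + 1 : ℕ) : ℤ) * (((n + 1 : ℕ) : ℤ) + 1)) * τ : ℂ).re =
        (((n + 1) * (n + 2) : ℕ) : ℝ) * (-π * τ.im) := by
      rw [show (π * I * (((n + 1 : ℕ) : ℤ) * (((n + 1 : ℕ) : ℤ) + 1)) * τ : ℂ) =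
        ((((n + 1) * (n + 2) : ℕ) : ℝ) * π : ℝ) * (τ * I) by push_cast; ring,
        re_ofReal_mul, mul_I_re]
      ring
    rw [this]
    refine mul_le_mul_of_nonpos_right ?_ (by nlinarith [Real.pi_pos])
    exact_mod_cast (by nlinarith : n + 1 ≤ (n + 1) * (n + 2))
  have hgeom : HasSum (fun n : ℕ ↦ r ^ (n + 1)) (r / (1 - r)) := by
    simp_rw [pow_succ', div_eq_mul_inv]
    exact (hasSum_geometric_of_lt_one hr0.le (by linarith)).mul_left r
  have htail : ‖∑' n : ℕ, jacobiTheta₂_term (n + 1 : ℕ) (τ / 2) τ‖ ≤ r / (1 - r) :=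
    tsum_of_norm_bounded hgeom hbound
  rw [hsum, hs1.tsum_eq_zero_add]
  intro h0
  have h1 : jacobiTheta₂_term (0 : ℕ) (τ / 2) τ = 1 := by simp [hterm]
  rw [h1, mul_eq_zero, or_iff_right two_ne_zero, add_comm, ← eq_neg_iff_add_eq_zero] at h0
  rw [h0, norm_neg, norm_one, le_div_iff₀ (by linarith)] at htail
  linarith

/-- Every SL₂(ℤ)-orbit meets Im τ ≥ 1/2, where the series estimates apply. There θ₄ is handled as θ₃
at τ + 1. -/
lemma thetaConstantsNeZero (τ : ℍ) : ThetaConstantsNeZero τ := by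
  obtain ⟨γ, hγ⟩ := ModularGroup.exists_one_half_le_im_smul τ
  rw [← thetaConstantsNeZero_smul γ]
  refine ⟨?_, ?_, jacobiTheta₂_half_tau_ne_zero_of_half_le_im hγ⟩
  · rw [← jacobiTheta_eq_jacobiTheta₂]
    exact jacobiTheta_ne_zero_of_half_le_im hγ
  · rw [← jacobiTheta₂_zero_add_one, ← jacobiTheta_eq_jacobiTheta₂]
    exact jacobiTheta_ne_zero_of_half_le_im (by simpa using hγ)

lemma jacobiTheta_ne_zero {τ : ℂ} (hτ : 0 < τ.im) : jacobiTheta τ ≠ 0 := by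
  rw [jacobiTheta_eq_jacobiTheta₂]
  exact (thetaConstantsNeZero ⟨τ, hτ⟩).1

lemma theta_ne_zero (τ : ℍ) : theta τ ≠ 0 :=
  jacobiTheta_ne_zero (by simpa using τ.im_pos)

end Nonvanishing

/-! ### Periodicity of the Jacobi symbol in the lower argument -/

section JacobiSymbol

open NumberTheorySymbols

lemma jacobiSym_eq_of_mod_eq {k m n : ℕ} (hm : Odd m) (hn : Odd n) (h : m % (4 * k) = n % (4 * k)) :
    J((4 * k : ℕ) | m) = J((4 * k : ℕ) | n) := by
  have h4 {b : ℕ} (hb : Odd b) : J((4 * k : ℕ) | b) = J(k | b) := by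
    rw [Nat.cast_mul, jacobiSym.mul_left, Nat.cast_ofNat, jacobiSym.at_four hb, one_mul]
  rw [h4 hm, h4 hn, jacobiSym.mod_right' k hm, jacobiSym.mod_right' k hn, h]

lemma jacobiSym_congr_left {a b : ℤ} {n : ℕ} (h : (n : ℤ) ∣ a - b) : J(a | n) = J(b | n) :=
  jacobiSym.mod_left' (Int.modEq_iff_dvd.mpr h).symm

lemma jacobiSym_self_sub_one {n : ℕ} (hn : 0 < n) : J(n | n - 1) = 1 := by
  rw [jacobiSym_congr_left (b := 1) (by rw [Nat.cast_sub hn, Nat.cast_one]), jacobiSym.one_left]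

/-- The character (4k/·) is even: mn ≡ -m² ≡ m²(4k - 1) mod 4k, and (4k/(4k - 1)) = 1. This covers
the case where d and d + c have opposite signs. -/
lemma jacobiSym_eq_of_add_eq {k m n : ℕ} (hm : Odd m) (hn : Odd n) (h : m + n = 4 * k)
    (hco : Nat.Coprime (4 * k) m) : J((4 * k : ℕ) | m) = J((4 * k : ℕ) | n) := by
  have hk : 0 < 4 * k := by have := hm.pos; omega
  have hco' : Nat.Coprime (4 * k) n := by
    rw [← h] at hco ⊢
    simpa [Nat.coprime_comm] using hco
  have hodd : Odd (4 * k - 1) := ⟨2 * k - 1, by omega⟩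
  have hprod : J((4 * k : ℕ) | m * n) = J((4 * k : ℕ) | m * m * (4 * k - 1)) := by
    refine jacobiSym_eq_of_mod_eq (hm.mul hn) ((hm.mul hm).mul hodd) ?_
    apply (Nat.modEq_iff_dvd (n := 4 * k)).mpr
    have hn' : (n : ℤ) = (4 * k : ℕ) - m := by omega
    rw [Nat.cast_mul (m * m), Nat.cast_mul m m, Nat.cast_mul m n, Nat.cast_sub hk, hn']
    exact ⟨m * m - m, by push_cast; ring⟩
  have : NeZero m := ⟨hm.pos.ne'⟩
  have : NeZero n := ⟨hn.pos.ne'⟩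
  have : NeZero (4 * k - 1) := ⟨hodd.pos.ne'⟩
  rw [jacobiSym.mul_right, jacobiSym.mul_right, jacobiSym.mul_right, jacobiSym_self_sub_one hk]
    at hprod
  have h1 := jacobiSym.eq_one_or_neg_one (a := ((4 * k : ℕ) : ℤ)) (b := m) hco
  have h2 := jacobiSym.eq_one_or_neg_one (a := ((4 * k : ℕ) : ℤ)) (b := n) hco'
  rcases h1 with h1 | h1 <;> rcases h2 with h2 | h2 <;> rw [h1, h2] at hprod ⊢ <;> norm_num at hprod

/-- The symbol `(|c| / |d|)`. -/
def absJacobi (c d : ℤ) : ℤ := J(|c| | d.natAbs)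

lemma absJacobi_add_right {c d : ℤ} (hc : 4 ∣ c) (hd : Odd d) (hco : IsCoprime c d) :
    absJacobi c (d + c) = absJacobi c d := by
  have key {k : ℕ} {x : ℤ} (hx : Odd x) (hco : IsCoprime ((4 * k : ℕ) : ℤ) x) :
      J((4 * k : ℕ) | (x + (4 * k : ℕ)).natAbs) = J((4 * k : ℕ) | x.natAbs) := by
    have hx' : Odd (x + (4 * k : ℕ)) := by
      obtain ⟨y, rfl⟩ := hx
      exact ⟨y + 2 * k, by push_cast; ring⟩
    rw [← Int.natAbs_odd] at hx hx'
    rcases le_or_gt 0 x with h0 | h0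
    · apply jacobiSym_eq_of_mod_eq hx' hx
      rw [Int.natAbs_add_of_nonneg h0 (by positivity), Int.natAbs_natCast, Nat.add_mod_right]
    rcases le_or_gt (x + (4 * k : ℕ)) 0 with h1 | h1
    · apply jacobiSym_eq_of_mod_eq hx' hx
      rw [show x.natAbs = (x + (4 * k : ℕ)).natAbs + 4 * k by omega]
      simp
    · refine (jacobiSym_eq_of_add_eq hx hx' (by omega) ?_).symm
      exact Int.isCoprime_iff_gcd_eq_one.mp hco
  obtain ⟨k, hk⟩ : ∃ k : ℕ, |c| = (4 * k : ℕ) := by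
    obtain ⟨e, rfl⟩ := hc
    exact ⟨e.natAbs, by rw [abs_mul]; simp⟩
  unfold absJacobi
  rcases abs_choice c with h | h <;> rw [h] at hk
  · subst hk
    rw [h, key hd hco]
  · obtain rfl : c = -(4 * k : ℕ) := by omega
    have hd' : Odd (d - (4 * k : ℕ)) := by
      obtain ⟨y, rfl⟩ := hd
      exact ⟨y - 2 * k, by push_cast; ring⟩
    have := key (k := k) hd' (by
      have h1 := (IsCoprime.neg_left_iff _ _).mp hco
      simpa [sub_eq_add_neg] using h1.add_mul_left_right (-1))
    rw [h, neg_neg, ← sub_eq_add_neg, ← this, sub_add_cancel]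

lemma absJacobi_add_left_of_same_sign {c d : ℤ} (h : 0 ≤ c ∧ 0 ≤ c + 4 * d ∨ c ≤ 0 ∧ c + 4 * d ≤ 0) :
    absJacobi (c + 4 * d) d = absJacobi c d := by
  apply jacobiSym_congr_left
  rw [Int.natAbs_dvd]
  rcases h with ⟨h1, h2⟩ | ⟨h1, h2⟩
  · rw [abs_of_nonneg h1, abs_of_nonneg h2]
    exact ⟨4, by ring⟩
  · rw [abs_of_nonpos h1, abs_of_nonpos h2]
    exact ⟨-4, by ring⟩

/-- When c changes sign, |c + 4d| ≡ -|c| mod d, and (-1/|d|) is the extra factor. It will compensate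
a change of branch of the square root. -/
lemma absJacobi_add_left_of_opposite_sign {c d : ℤ} (hd : Odd d)
    (h : 0 ≤ c ∧ c + 4 * d ≤ 0 ∨ c ≤ 0 ∧ 0 ≤ c + 4 * d) :
    absJacobi (c + 4 * d) d = ZMod.χ₄ d.natAbs * absJacobi c d := by
  unfold absJacobi
  rw [← jacobiSym.neg _ (Int.natAbs_odd.mpr hd)]
  apply jacobiSym_congr_left
  rw [Int.natAbs_dvd]
  rcases h with ⟨h1, h2⟩ | ⟨h1, h2⟩
  · rw [abs_of_nonneg h1, abs_of_nonpos h2]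
    exact ⟨-4, by ring⟩
  · rw [abs_of_nonpos h1, abs_of_nonneg h2]
    exact ⟨4, by ring⟩

lemma absJacobi_eq_one_of_dvd_sub_one {c : ℤ} (hc : 4 ∣ c) {d : ℤ} (hd : c ∣ d - 1) :
    absJacobi c d = 1 := by
  obtain ⟨k, hk⟩ := hd
  obtain rfl : d = 1 + k * c := by linarith
  clear hk
  have hodd (k : ℤ) : Odd (1 + k * c) := by
    obtain ⟨e, rfl⟩ := hc
    exact ⟨2 * k * e, by ring⟩
  have hco (k : ℤ) : IsCoprime c (1 + k * c) := isCoprime_one_right.add_mul_right_right k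
  induction k using Int.induction_on with
  | zero => simp [absJacobi]
  | succ n ih =>
    rw [add_mul (n : ℤ), one_mul, ← add_assoc, absJacobi_add_right hc (hodd n) (hco n), ih]
  | pred n ih =>
    rw [← absJacobi_add_right hc (hodd _) (hco _), add_assoc, ← add_one_mul, sub_add_cancel, ih]

/-- Since d ≡ 1 mod 4p, the symbol (4p/|d|) is 1; dropping the square 4 leaves (p/|d|) = 1. -/
lemma absJacobi_mul_natCast (p : ℕ) {c d : ℤ} (hd : (4 * p : ℤ) ∣ d - 1) :
    absJacobi (c * p) d = absJacobi c d := by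
  have hodd : Odd d := by
    obtain ⟨k, hk⟩ := hd
    exact ⟨2 * p * k, by linarith⟩
  have h1 := absJacobi_eq_one_of_dvd_sub_one (Int.dvd_mul_right 4 p) hd
  unfold absJacobi at h1 ⊢
  rw [abs_mul, jacobiSym.mul_left, abs_of_pos (by norm_num),
    jacobiSym.at_four (Int.natAbs_odd.mpr hodd), one_mul] at h1
  rw [abs_mul, jacobiSym.mul_left, h1, mul_one]

end JacobiSymbol

/-! ### The transformation law of the theta function -/

section ThetaLaw

open Complex

lemma coe_SL2Z_smul (γ : SL(2, ℤ)) (τ : ℍ) :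
    ((γ • τ : ℍ) : ℂ) = (γ 0 0 * τ + γ 0 1) / (γ 1 0 * τ + γ 1 1) := by
  rw [coe_specialLinearGroup_apply]
  simp

lemma SL2Z_denom_ne_zero (γ : SL(2, ℤ)) (τ : ℍ) : (γ 1 0 * τ + γ 1 1 : ℂ) ≠ 0 := by
  have := denom_ne_zero γ τ
  rwa [ModularGroup.denom_apply] at this

lemma SL2Z_det (γ : SL(2, ℤ)) : γ 0 0 * γ 1 1 - γ 0 1 * γ 1 0 = 1 := by
  rw [← Matrix.det_fin_two, γ.det_coe]

lemma eq_of_sq_eq_of_re_pos {r s : ℂ} (h : r ^ 2 = s ^ 2) (hr : 0 < r.re) (hs : 0 < s.re) :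
    r = s := by
  rcases sq_eq_sq_iff_eq_or_eq_neg.mp h with h | h
  · exact h
  · rw [h, neg_re] at hr
    linarith

lemma eq_of_sq_eq_of_im_pos {r s : ℂ} (h : r ^ 2 = s ^ 2) (hr : 0 < r.im) (hs : 0 < s.im) :
    r = s := by
  rcases sq_eq_sq_iff_eq_or_eq_neg.mp h with h | h
  · exact h
  · rw [h, neg_im] at hr
    linarith

lemma re_cpow_half_pos {z : ℂ} (hz : z ∈ slitPlane) : 0 < (z ^ (1 / 2 : ℂ)).re := by
  rw [cpow_def_of_ne_zero (slitPlane_ne_zero hz), exp_re]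
  refine mul_pos (Real.exp_pos _) (Real.cos_pos_of_mem_Ioo ?_)
  have him : (log z * (1 / 2)).im = z.arg / 2 := by
    rw [show (1 / 2 : ℂ) = ((1 / 2 : ℝ) : ℂ) by norm_num, im_mul_ofReal, log_im]
    ring
  have h1 := neg_pi_lt_arg z
  have h2 := lt_of_le_of_ne (arg_le_pi z) (mem_slitPlane_iff_arg.mp hz).1
  rw [him]
  constructor <;> linarith

lemma cpow_half_sq (z : ℂ) : (z ^ (1 / 2 : ℂ)) ^ 2 = z := by
  rw [← cpow_nat_mul]
  simp

lemma exists_sq_eq_of_mem_slitPlane {z : ℂ} (hz : z ∈ slitPlane) :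
    ∃ r : ℂ, r ^ 2 = z ∧ 0 < r.re :=
  ⟨z ^ (1 / 2 : ℂ), cpow_half_sq z, re_cpow_half_pos hz⟩

lemma theta_intCast_vadd (n : ℤ) (τ : ℍ) : theta ((n : ℝ) +ᵥ τ) = theta τ := by
  have h : Function.Periodic jacobiTheta 2 := fun z ↦ by rw [add_comm, jacobiTheta_two_add]
  rw [theta, theta, coe_vadd, ← h.int_mul n (2 * τ)]
  push_cast
  ring_nf

/-- The matrix `(1, 0; c, 1)`. -/
def lowerUnipotent (c : ℤ) : SL(2, ℤ) := ⟨!![1, 0; c, 1], by simp [Matrix.det_fin_two]⟩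

lemma coe_lowerUnipotent (c : ℤ) :
    (lowerUnipotent c : Matrix (Fin 2) (Fin 2) ℤ) = !![1, 0; c, 1] := rfl

lemma coe_lowerUnipotent_smul (c : ℤ) (τ : ℍ) :
    ((lowerUnipotent c • τ : ℍ) : ℂ) = τ / (c * τ + 1) := by
  rw [coe_SL2Z_smul]
  simp [coe_lowerUnipotent]

/-- With σ the image of τ, -1/(2σ) = -1/(2τ) - 2. Jacobi inversion at both points, together with the
period 2 of `jacobiTheta`, gives the formula up to the choice of root. -/
lemma theta_lowerUnipotent_four_smul (τ : ℍ) {r : ℂ} (hr : r ^ 2 = 4 * τ + 1) (hr0 : 0 < r.re) :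
    theta (lowerUnipotent 4 • τ) = r * theta τ := by
  set σ := lowerUnipotent 4 • τ with hσ
  have hσc : (σ : ℂ) = τ / (4 * τ + 1) := by
    rw [hσ, coe_lowerUnipotent_smul]
    norm_num
  have hd : (4 * τ + 1 : ℂ) ≠ 0 := by
    rw [← hr]
    exact pow_ne_zero 2 fun h ↦ by simp [h] at hr0
  have hτ0 := τ.ne_zero
  have hslit (z : ℍ) : -I * (2 * z) ∈ slitPlane := Or.inl (by simpa using z.im_pos)
  have hS (z : ℍ) : jacobiTheta (-1 / (2 * z)) = (-I * (2 * z)) ^ (1 / 2 : ℂ) * theta z := by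
    have := jacobiTheta_S_smul ⟨2 * z, by simpa using z.im_pos⟩
    rw [modular_S_smul] at this
    simpa [theta, neg_div] using this
  -- Principal roots of numbers in the right half plane lie in |arg| < π/4, so a quotient of two of
  -- them has positive real part. This fixes the sign of r.
  have hsector (z : ℍ) : 0 < ((-I * (2 * z)) ^ (1 / 2 : ℂ)).re ∧
      ((-I * (2 * z)) ^ (1 / 2 : ℂ)).im ^ 2 < ((-I * (2 * z)) ^ (1 / 2 : ℂ)).re ^ 2 := by
    constructor
    · exact re_cpow_half_pos (hslit z)
    · have := congrArg re (cpow_half_sq (-I * (2 * z)))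
      rw [sq, mul_re] at this
      have h2 : 0 < (-I * (2 * z)).re := by simpa using z.im_pos
      nlinarith
  have hperiod : jacobiTheta (-1 / (2 * σ)) = jacobiTheta (-1 / (2 * τ)) := by
    rw [← jacobiTheta_two_add (-1 / (2 * σ))]
    congr 1
    rw [hσc]
    field_simp
    ring
  rw [hS, hS] at hperiod
  set R := (-I * (2 * τ : ℂ)) ^ (1 / 2 : ℂ)
  set R' := (-I * (2 * σ : ℂ)) ^ (1 / 2 : ℂ)
  have hR' : R' ≠ 0 := fun h ↦ (hsector σ).1.ne' (congrArg re h)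
  have hRR' : R / R' = r := by
    refine eq_of_sq_eq_of_re_pos ?_ ?_ hr0
    · rw [div_pow, cpow_half_sq, cpow_half_sq, hr, hσc]
      field_simp
    · rw [div_re, ← add_div]
      refine div_pos ?_ (normSq_pos.mpr hR')
      have h1 := abs_lt_of_sq_lt_sq (hsector τ).2 (hsector τ).1.le
      have h2 := abs_lt_of_sq_lt_sq (hsector σ).2 (hsector σ).1.le
      have h3 : |R.im * R'.im| < R.re * R'.re := by
        rw [abs_mul]
        exact mul_lt_mul'' h1 h2 (abs_nonneg _) (abs_nonneg _)
      linarith [neg_abs_le (R.im * R'.im)]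
  rw [← hRR', div_mul_eq_mul_div, eq_div_iff hR', ← hperiod, mul_comm]

/-- The transformation law `θ(γτ) = (|c| / |d|) (cτ + d)^{1/2} θ(τ)`, with the square root in the
right half plane. -/
def ThetaLaw (γ : SL(2, ℤ)) : Prop :=
  ∀ (τ : ℍ) (r : ℂ), r ^ 2 = γ 1 0 * τ + γ 1 1 → 0 < r.re →
    theta (γ • τ) = absJacobi (γ 1 0) (γ 1 1) * r * theta τ

lemma thetaLaw_of_mul_T_zpow {γ : SL(2, ℤ)} {n : ℤ}
    (hn : absJacobi (γ 1 0) (γ 1 1 + n * γ 1 0) = absJacobi (γ 1 0) (γ 1 1))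
    (h : ThetaLaw (γ * ModularGroup.T ^ n)) : ThetaLaw γ := by
  intro τ r hr hr0
  have h10 : (γ * ModularGroup.T ^ n) 1 0 = γ 1 0 := by
    simp [Matrix.mul_apply, ModularGroup.coe_T_zpow]
  have h11 : (γ * ModularGroup.T ^ n) 1 1 = γ 1 1 + n * γ 1 0 := by
    simp [Matrix.mul_apply, ModularGroup.coe_T_zpow]
    ring
  have hτ : τ = ModularGroup.T ^ n • (ModularGroup.T ^ (-n) • τ) := by
    rw [smul_smul, zpow_neg, mul_inv_cancel, one_smul]
  have hc : ((ModularGroup.T ^ (-n) • τ : ℍ) : ℂ) = τ - n := by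
    rw [modular_T_zpow_smul, coe_vadd]
    push_cast
    ring
  have := h (ModularGroup.T ^ (-n) • τ) r (by rw [hr, h10, h11, hc]; push_cast; ring) hr0
  rwa [h10, h11, hn, mul_smul, ← hτ, modular_T_zpow_smul, theta_intCast_vadd] at this

/-- This is the cocycle identity behind right multiplication by (1, 0; 4, 1). The products AB and C
agree up to sign. The sign is -1 exactly when c > 0 > c + 4d; then d < 0 and |d| ≡ 3 mod 4, so the
symbol changes sign too. In the other sign change, c ≤ 0 < c + 4d, |d| ≡ 1 mod 4 and nothing
changes. -/
lemma absJacobi_mul_sqrt_mul_sqrt {c d : ℤ} (hd : d % 4 = 1) (hco : IsCoprime c d)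
    {τ v : ℍ} (hv : (v : ℂ) * (4 * τ + 1) = τ) {A B C : ℂ} (hA : A ^ 2 = c * v + d)
    (hA0 : 0 < A.re) (hB : B ^ 2 = 4 * τ + 1) (hB0 : 0 < B.re)
    (hC : C ^ 2 = (c + 4 * d : ℤ) * τ + d) (hC0 : 0 < C.re) :
    (absJacobi c d : ℂ) * (A * B) = absJacobi (c + 4 * d) d * C := by
  have hsq : (A * B) ^ 2 = C ^ 2 := by
    rw [mul_pow, hA, hB, hC]
    push_cast
    linear_combination (c : ℂ) * hv
  have hAim : 2 * A.re * A.im = c * v.im := by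
    have := congrArg im hA
    rw [sq, mul_im] at this
    simp at this
    linarith
  have hBim : 2 * B.re * B.im = 4 * τ.im := by
    have := congrArg im hB
    rw [sq, mul_im] at this
    simp at this
    linarith
  have hCim : 2 * C.re * C.im = (c + 4 * d : ℤ) * τ.im := by
    have := congrArg im hC
    rw [sq, mul_im] at this
    simp at this
    push_cast
    linarith
  have hBim0 : 0 < B.im := by
    have := τ.im_pos
    by_contra hneg
    nlinarith
  have hodd : Odd d := Int.odd_iff.mpr (by omega)
  rcases le_or_gt c 0 with hc | hc
  · have hAim0 : A.im ≤ 0 := by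
      have h1 : (c : ℝ) * v.im ≤ 0 :=
        mul_nonpos_of_nonpos_of_nonneg (by exact_mod_cast hc) v.im_pos.le
      by_contra hneg
      nlinarith [mul_pos hA0 (not_le.mp hneg)]
    have hABC : A * B = C := by
      refine eq_of_sq_eq_of_re_pos hsq ?_ hC0
      rw [mul_re]
      nlinarith [mul_pos hA0 hB0]
    rw [hABC]
    rcases le_or_gt (c + 4 * d) 0 with h1 | h1
    · rw [absJacobi_add_left_of_same_sign (Or.inr ⟨hc, h1⟩)]
    · rw [absJacobi_add_left_of_opposite_sign hodd (Or.inr ⟨hc, h1.le⟩),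
        ZMod.χ₄_nat_one_mod_four (by omega), one_mul]
  · have hAim0 : 0 < A.im := by
      have h1 : 0 < (c : ℝ) * v.im := mul_pos (by exact_mod_cast hc) v.im_pos
      by_contra hneg
      nlinarith
    have hABim : 0 < (A * B).im := by
      rw [mul_im]
      positivity
    rcases lt_trichotomy (c + 4 * d) 0 with h1 | h1 | h1
    · have hCim0 : 0 < (-C).im := by
        have h2 : ((c + 4 * d : ℤ) : ℝ) * τ.im < 0 :=
          mul_neg_of_neg_of_pos (by exact_mod_cast h1) τ.im_pos
        rw [neg_im]
        by_contra hneg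
        nlinarith
      have hABC : A * B = -C := eq_of_sq_eq_of_im_pos (by rw [hsq, neg_sq]) hABim hCim0
      rw [hABC, absJacobi_add_left_of_opposite_sign hodd (Or.inl ⟨hc.le, h1.le⟩),
        ZMod.χ₄_nat_three_mod_four (by omega)]
      push_cast
      ring
    · obtain rfl : c = 4 * -d := by linarith
      rw [mul_neg, IsCoprime.neg_left_iff, mul_comm] at hco
      have := Int.isUnit_iff.mp (hco.isUnit_of_dvd' (Dvd.intro _ rfl) dvd_rfl)
      omega
    · have hCim0 : 0 < C.im := by
        have h2 : 0 < ((c + 4 * d : ℤ) : ℝ) * τ.im :=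
          mul_pos (by exact_mod_cast h1) τ.im_pos
        by_contra hneg
        nlinarith
      rw [eq_of_sq_eq_of_im_pos hsq hABim hCim0,
        absJacobi_add_left_of_same_sign (Or.inl ⟨hc.le, h1.le⟩)]

lemma SL2Z_isCoprime (γ : SL(2, ℤ)) : IsCoprime (γ 1 0) (γ 1 1) :=
  ⟨-γ 0 1, γ 0 0, by linear_combination SL2Z_det γ⟩

lemma SL2Z_denom_mem_slitPlane {γ : SL(2, ℤ)} (hd : γ 1 1 % 4 = 1) (τ : ℍ) :
    (γ 1 0 * τ + γ 1 1 : ℂ) ∈ slitPlane := by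
  rcases eq_or_ne (γ 1 0) 0 with hc | hc
  · have hco := SL2Z_isCoprime γ
    rw [hc, isCoprime_zero_left, Int.isUnit_iff] at hco
    have : γ 1 1 = 1 := by omega
    simp [hc, this]
  · refine Or.inr ?_
    simpa [τ.im_ne_zero] using hc

lemma mul_lowerUnipotent_apply (γ : SL(2, ℤ)) (c : ℤ) :
    (γ * lowerUnipotent c) 0 0 = γ 0 0 + c * γ 0 1 ∧ (γ * lowerUnipotent c) 0 1 = γ 0 1 ∧
    (γ * lowerUnipotent c) 1 0 = γ 1 0 + c * γ 1 1 ∧ (γ * lowerUnipotent c) 1 1 = γ 1 1 := by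
  simp [Matrix.mul_apply, coe_lowerUnipotent, mul_comm]

lemma lowerUnipotent_four_smul_mul (τ : ℍ) :
    ((lowerUnipotent 4 • τ : ℍ) : ℂ) * (4 * τ + 1) = τ := by
  have h := SL2Z_denom_ne_zero (lowerUnipotent 4) τ
  rw [coe_lowerUnipotent_smul]
  simp only [coe_lowerUnipotent, Matrix.of_apply, Matrix.cons_val', Matrix.cons_val_zero,
    Matrix.cons_val_one] at h
  push_cast at h ⊢
  exact div_mul_cancel₀ _ h

lemma four_mul_add_one_mem_slitPlane (τ : ℍ) : (4 * τ + 1 : ℂ) ∈ slitPlane :=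
  Or.inr (by simp [τ.im_ne_zero])

lemma thetaLaw_mul_lowerUnipotent_four {γ : SL(2, ℤ)} (hd : γ 1 1 % 4 = 1) (h : ThetaLaw γ) :
    ThetaLaw (γ * lowerUnipotent 4) := by
  intro τ C hC hC0
  obtain ⟨-, -, h10, h11⟩ := mul_lowerUnipotent_apply γ 4
  rw [h10, h11] at hC ⊢
  obtain ⟨A, hA, hA0⟩ :=
    exists_sq_eq_of_mem_slitPlane (SL2Z_denom_mem_slitPlane hd (lowerUnipotent 4 • τ))
  obtain ⟨B, hB, hB0⟩ := exists_sq_eq_of_mem_slitPlane (four_mul_add_one_mem_slitPlane τ)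
  rw [mul_smul, h _ A hA hA0, theta_lowerUnipotent_four_smul τ hB hB0,
    ← absJacobi_mul_sqrt_mul_sqrt hd (SL2Z_isCoprime γ) (lowerUnipotent_four_smul_mul τ) hA hA0 hB
      hB0 hC hC0]
  ring

lemma thetaLaw_of_mul_lowerUnipotent_four {γ : SL(2, ℤ)} (hd : γ 1 1 % 4 = 1)
    (h : ThetaLaw (γ * lowerUnipotent 4)) : ThetaLaw γ := by
  intro σ A hA hA0
  obtain ⟨τ, rfl⟩ : ∃ τ : ℍ, σ = lowerUnipotent 4 • τ :=
    ⟨(lowerUnipotent 4)⁻¹ • σ, (smul_inv_smul _ _).symm⟩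
  obtain ⟨-, -, h10, h11⟩ := mul_lowerUnipotent_apply γ 4
  obtain ⟨B, hB, hB0⟩ := exists_sq_eq_of_mem_slitPlane (four_mul_add_one_mem_slitPlane τ)
  obtain ⟨C, hC, hC0⟩ := exists_sq_eq_of_mem_slitPlane
    (SL2Z_denom_mem_slitPlane (γ := γ * lowerUnipotent 4) (by rwa [h11]) τ)
  have := h τ C hC hC0
  rw [h10, h11] at hC this
  rw [← mul_smul, this, theta_lowerUnipotent_four_smul τ hB hB0,
    ← absJacobi_mul_sqrt_mul_sqrt hd (SL2Z_isCoprime γ) (lowerUnipotent_four_smul_mul τ) hA hA0 hB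
      hB0 hC hC0]
  ring

lemma thetaLaw_of_lower_left_eq_zero {γ : SL(2, ℤ)} (hc : γ 1 0 = 0) (hd : γ 1 1 % 4 = 1) :
    ThetaLaw γ := by
  have hco := SL2Z_isCoprime γ
  rw [hc, isCoprime_zero_left, Int.isUnit_iff] at hco
  have hd1 : γ 1 1 = 1 := by omega
  have ha1 : γ 0 0 = 1 := by simpa [hc, hd1] using SL2Z_det γ
  intro τ r hr hr0
  have hτ : γ • τ = (γ 0 1 : ℝ) +ᵥ τ := by
    ext
    rw [coe_SL2Z_smul, coe_vadd, hc, hd1, ha1]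
    push_cast
    ring
  have hr1 : r = 1 := eq_of_sq_eq_of_re_pos (by rw [hr, hc, hd1]; simp) hr0 (by simp)
  rw [hτ, theta_intCast_vadd, hc, hd1, hr1]
  simp [absJacobi]

lemma mul_T_zpow_apply (γ : SL(2, ℤ)) (n : ℤ) :
    (γ * ModularGroup.T ^ n) 0 0 = γ 0 0 ∧
    (γ * ModularGroup.T ^ n) 0 1 = γ 0 1 + n * γ 0 0 ∧
    (γ * ModularGroup.T ^ n) 1 0 = γ 1 0 ∧
    (γ * ModularGroup.T ^ n) 1 1 = γ 1 1 + n * γ 1 0 := by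
  simp [Matrix.mul_apply, ModularGroup.coe_T_zpow, mul_comm, add_comm]

/-- The transformation law of the theta function under `Γ₁(4)`. -/
theorem thetaLaw_of_mem_Gamma1_four (γ : SL(2, ℤ)) (hc : 4 ∣ γ 1 0) (hd : γ 1 1 % 4 = 1) :
    ThetaLaw γ := by
  induction hN : (γ 1 0).natAbs + (γ 1 1).natAbs using Nat.strong_induction_on generalizing γ with
  | _ N ih =>
  subst hN
  have hT (n : ℤ) := mul_T_zpow_apply γ n
  have hV := mul_lowerUnipotent_apply γ 4
  have hodd : Odd (γ 1 1) := Int.odd_iff.mpr (by omega)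
  have hco := SL2Z_isCoprime γ
  rcases eq_or_ne (γ 1 0) 0 with h0 | h0
  · exact thetaLaw_of_lower_left_eq_zero h0 hd
  -- Replacing c by c ± 4d shrinks |c| if |c| > 2|d|, and replacing d by d ± c shrinks |d| if 0 <
  -- |c| < 2|d|. Equality is impossible because 4 ∣ c and d is odd. The signs of c and d decide the
  -- direction.
  rcases lt_or_ge (2 * (γ 1 1).natAbs) (γ 1 0).natAbs with h1 | h1
  · by_cases hs : 0 < γ 1 0 ↔ 0 < γ 1 1
    · set δ := γ * (lowerUnipotent 4)⁻¹ with hδ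
      have hγ : γ = δ * lowerUnipotent 4 := by rw [hδ, inv_mul_cancel_right]
      obtain ⟨-, -, h10, h11⟩ := mul_lowerUnipotent_apply δ 4
      rw [← hγ] at h10 h11
      rw [hγ]
      exact thetaLaw_mul_lowerUnipotent_four (by omega) (ih _ (by omega) δ (by omega) (by omega) rfl)
    · exact thetaLaw_of_mul_lowerUnipotent_four hd
        (ih _ (by omega) _ (by omega) (by omega) rfl)
  · by_cases hs : 0 < γ 1 0 ↔ 0 < γ 1 1
    · obtain ⟨-, -, h10, h11⟩ := hT (-1)
      refine thetaLaw_of_mul_T_zpow (n := -1) ?_ (ih _ (by omega) _ (by omega) (by omega) rfl)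
      rw [← absJacobi_add_right hc]
      · congr 1
        ring
      · obtain ⟨x, hx⟩ := hodd
        obtain ⟨y, hy⟩ := hc
        exact ⟨x - 2 * y, by rw [hx, hy]; ring⟩
      · simpa using hco.add_mul_right_right (-1)
    · obtain ⟨-, -, h10, h11⟩ := hT 1
      refine thetaLaw_of_mul_T_zpow (n := 1) ?_ (ih _ (by omega) _ (by omega) (by omega) rfl)
      rw [one_mul, absJacobi_add_right hc hodd hco]

lemma thetaFactor_eq {γ : SL(2, ℤ)} (hc : 4 ∣ γ 1 0) (hd : γ 1 1 % 4 = 1) (τ : ℍ) {r : ℂ}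
    (hr : r ^ 2 = γ 1 0 * τ + γ 1 1) (hr0 : 0 < r.re) :
    thetaFactor γ τ = absJacobi (γ 1 0) (γ 1 1) * r := by
  rw [thetaFactor, thetaLaw_of_mem_Gamma1_four γ hc hd τ r hr hr0,
    mul_div_cancel_right₀ _ (theta_ne_zero τ)]

lemma thetaFactor_mul (γ δ : SL(2, ℤ)) (τ : ℍ) :
    thetaFactor (γ * δ) τ = thetaFactor γ (δ • τ) * thetaFactor δ τ := by
  rw [thetaFactor, thetaFactor, thetaFactor, mul_smul, div_mul_div_cancel₀ (theta_ne_zero _)]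

lemma thetaFactor_inv (γ : SL(2, ℤ)) (τ : ℍ) :
    thetaFactor γ⁻¹ τ = (thetaFactor γ (γ⁻¹ • τ))⁻¹ := by
  rw [thetaFactor, thetaFactor, inv_div, smul_inv_smul]

lemma thetaFactor_ne_zero (γ : SL(2, ℤ)) (τ : ℍ) : thetaFactor γ τ ≠ 0 :=
  div_ne_zero (theta_ne_zero _) (theta_ne_zero _)

lemma thetaFactor_T (τ : ℍ) : thetaFactor ModularGroup.T τ = 1 := by
  rw [thetaFactor, modular_T_smul, ← Int.cast_one, theta_intCast_vadd, div_self (theta_ne_zero _)]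

/-- The set of `γ` under which `f` transforms with weight `l / 2`, as a subgroup. -/
def transformSubgroup (l : ℕ) (f : ℍ → ℂ) : Subgroup SL(2, ℤ) where
  carrier := {γ | ∀ τ : ℍ, f (γ • τ) = thetaFactor γ τ ^ l * f τ}
  one_mem' τ := by simp [thetaFactor, div_self (theta_ne_zero τ)]
  mul_mem' {γ δ} hγ hδ τ := by rw [mul_smul, hγ, hδ, thetaFactor_mul, mul_pow, mul_assoc]
  inv_mem' {γ} hγ τ := by
    have h := hγ (γ⁻¹ • τ)
    rw [smul_inv_smul] at h
    rw [h, thetaFactor_inv, inv_pow, inv_mul_cancel_left₀ (pow_ne_zero l (thetaFactor_ne_zero _ _))]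

end ThetaLaw

/-! ### The form `τ ↦ h(τ / p)` -/

section Scaling

open Complex

lemma mem_Gamma1_iff_dvd {N : ℕ} {γ : SL(2, ℤ)} :
    γ ∈ CongruenceSubgroup.Gamma1 N ↔
      (N : ℤ) ∣ γ 0 0 - 1 ∧ (N : ℤ) ∣ γ 1 1 - 1 ∧ (N : ℤ) ∣ γ 1 0 := by
  simp only [CongruenceSubgroup.Gamma1_mem, ← CharP.intCast_eq_zero_iff (ZMod N) N, Int.cast_sub,
    Int.cast_one, sub_eq_zero]

lemma coe_divNat (p : ℕ) (hp : 0 < p) (τ : ℍ) : (divNat p hp τ : ℂ) = τ / p := rfl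

variable {l M p : ℕ} {h : ℍ → ℂ}

lemma mem_transformSubgroup_of_dvd (hp : 0 < p)
    (hh : ∀ γ ∈ CongruenceSubgroup.Gamma1 (4 * (p * M)), ∀ τ : ℍ,
      h (γ • τ) = thetaFactor γ τ ^ l * h τ) {γ : SL(2, ℤ)}
    (hb : (p : ℤ) ∣ γ 0 1) (hc : (4 * M : ℤ) ∣ γ 1 0) (ha : (4 * (p * M) : ℤ) ∣ γ 0 0 - 1)
    (hd : (4 * (p * M) : ℤ) ∣ γ 1 1 - 1) :
    γ ∈ transformSubgroup l fun τ ↦ h (divNat p hp τ) := by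
  obtain ⟨b, hb⟩ := hb
  have hp0 : (p : ℂ) ≠ 0 := by exact_mod_cast hp.ne'
  -- The conjugate diag(1, p) γ diag(1, p)⁻¹, where τ ↦ τ/p is the action of diag(1, p).
  let δ : SL(2, ℤ) := ⟨!![γ 0 0, b; γ 1 0 * p, γ 1 1], by
    have := SL2Z_det γ
    rw [hb] at this
    rw [Matrix.det_fin_two]
    simp only [Matrix.of_apply, Matrix.cons_val', Matrix.cons_val_zero, Matrix.cons_val_one]
    linear_combination this⟩
  have h00 : δ 0 0 = γ 0 0 := rfl
  have h01 : δ 0 1 = b := rfl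
  have h10 : δ 1 0 = γ 1 0 * p := rfl
  have h11 : δ 1 1 = γ 1 1 := rfl
  have hδ : δ ∈ CongruenceSubgroup.Gamma1 (4 * (p * M)) := by
    rw [mem_Gamma1_iff_dvd, h00, h10, h11]
    push_cast
    refine ⟨ha, hd, ?_⟩
    obtain ⟨k, hk⟩ := hc
    exact ⟨k, by rw [hk]; ring⟩
  have h4c : 4 ∣ γ 1 0 := (Dvd.intro _ rfl).trans hc
  have hd4 : γ 1 1 % 4 = 1 := by
    have : 4 ∣ γ 1 1 - 1 := (Dvd.intro _ rfl).trans hd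
    omega
  intro τ
  have hsmul : divNat p hp (γ • τ) = δ • divNat p hp τ := by
    ext
    have h1 := SL2Z_denom_ne_zero γ τ
    have h2 := SL2Z_denom_ne_zero δ (divNat p hp τ)
    rw [coe_divNat, coe_SL2Z_smul, coe_SL2Z_smul, coe_divNat, h00, h01, h10, h11, hb]
    rw [h10, h11, coe_divNat] at h2
    push_cast at h2 ⊢
    field_simp
  obtain ⟨r, hr, hr0⟩ := exists_sq_eq_of_mem_slitPlane (SL2Z_denom_mem_slitPlane hd4 τ)
  -- The same r serves both matrices, since (pc)(τ/p) + d = cτ + d.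
  have hfactor : thetaFactor δ (divNat p hp τ) = thetaFactor γ τ := by
    rw [thetaFactor_eq h4c hd4 τ hr hr0,
      thetaFactor_eq (γ := δ) (h4c.mul_right _) hd4 (r := r) _ _ hr0, h10, h11,
      absJacobi_mul_natCast p ((Dvd.intro (M : ℤ) (by ring)).trans hd)]
    rw [hr, h10, h11, coe_divNat]
    push_cast
    field_simp
  simp only [hsmul, hh δ hδ, hfactor]

lemma Gamma1_le_transformSubgroup (hp : p.Prime) (hM : 0 < M)
    (hh : ∀ γ ∈ CongruenceSubgroup.Gamma1 (4 * (p * M)), ∀ τ : ℍ,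
      h (γ • τ) = thetaFactor γ τ ^ l * h τ)
    (hT : ModularGroup.T ∈ transformSubgroup l fun τ ↦ h (divNat p hp.pos τ)) :
    CongruenceSubgroup.Gamma1 (4 * M) ≤ transformSubgroup l fun τ ↦ h (divNat p hp.pos τ) := by
  set G := transformSubgroup l fun τ ↦ h (divNat p hp.pos τ)
  have hM0 : (M : ℤ) ≠ 0 := by exact_mod_cast hM.ne'
  have hpZ : Prime (p : ℤ) := Nat.prime_iff_prime_int.mp hp
  have key {γ : SL(2, ℤ)} (hγ : γ ∈ CongruenceSubgroup.Gamma1 (4 * M))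
      (hc : ¬ (4 * M * p : ℤ) ∣ γ 1 0) : γ ∈ G := by
    obtain ⟨-, ⟨s, hs⟩, ⟨t, ht⟩⟩ := mem_Gamma1_iff_dvd.mp hγ
    push_cast at hs ht
    have hpt : ¬ (p : ℤ) ∣ t := fun hpt ↦ hc (ht ▸ mul_dvd_mul_left _ hpt)
    obtain ⟨u, v, huv⟩ := ((Prime.coprime_iff_not_dvd hpZ).mpr hpt).symm
    -- With d = 1 + 4Ms, c = 4Mt and ut + vp = 1, the exponent -su turns d into 1 + 4pM·sv.
    set γ₁ := γ * ModularGroup.T ^ (-s * u) with hγ₁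
    obtain ⟨-, -, h10, h11⟩ := mul_T_zpow_apply γ (-s * u)
    rw [← hγ₁] at h10 h11
    have h11' : γ₁ 1 1 - 1 = 4 * (p * M) * (s * v) := by
      rw [h11, ht]
      linear_combination hs - 4 * M * s * huv
    -- The upper right entry becomes b(1 - d), divisible by p because now d ≡ 1 mod 4pM. The
    -- determinant then forces the upper left entry to be 1 mod 4pM.
    set γ₂ := ModularGroup.T ^ (-γ₁ 0 1) * γ₁ with hγ₂
    have e00 : γ₂ 0 0 = γ₁ 0 0 - γ₁ 0 1 * γ₁ 1 0 := by
      simp [hγ₂, Matrix.mul_apply, ModularGroup.coe_T_zpow, sub_eq_add_neg]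
    have e01 : γ₂ 0 1 = γ₁ 0 1 - γ₁ 0 1 * γ₁ 1 1 := by
      simp [hγ₂, Matrix.mul_apply, ModularGroup.coe_T_zpow, sub_eq_add_neg]
    have e10 : γ₂ 1 0 = γ 1 0 := by
      rw [← h10]
      simp [hγ₂, Matrix.mul_apply, ModularGroup.coe_T_zpow]
    have e11 : γ₂ 1 1 = γ₁ 1 1 := by
      simp [hγ₂, Matrix.mul_apply, ModularGroup.coe_T_zpow]
    have e01' : γ₂ 0 1 = p * (-(γ₁ 0 1) * (4 * M * (s * v))) := by
      rw [e01]
      linear_combination -γ₁ 0 1 * h11'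
    have hG₂ : γ₂ ∈ G := by
      refine mem_transformSubgroup_of_dvd hp.pos hh ⟨_, e01'⟩ (by rw [e10, ht]; exact ⟨t, rfl⟩)
        ?_ (by rw [e11]; exact ⟨_, h11'⟩)
      have hdet := SL2Z_det γ₂
      refine ⟨-γ₁ 0 1 * (4 * M * (s * v)) * t - γ₂ 0 0 * (s * v), ?_⟩
      rw [e01', e10, e11, ht] at hdet
      linear_combination hdet - γ₂ 0 0 * h11'
    have hγ : γ = (ModularGroup.T ^ (-γ₁ 0 1))⁻¹ * γ₂ * (ModularGroup.T ^ (-s * u))⁻¹ := by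
      rw [hγ₂, hγ₁]
      group
    rw [hγ]
    exact G.mul_mem (G.mul_mem (G.inv_mem (G.zpow_mem hT _)) hG₂) (G.inv_mem (G.zpow_mem hT _))
  intro γ hγ
  by_cases hc : (4 * M * p : ℤ) ∣ γ 1 0
  -- If p divides c/(4M), it does not divide d, so adding 4Md to c leads back to the case already
  -- settled.
  · obtain ⟨-, -, h10, h11⟩ := mul_lowerUnipotent_apply γ (4 * M)
    have hV : lowerUnipotent (4 * M) ∈ CongruenceSubgroup.Gamma1 (4 * M) := by
      rw [mem_Gamma1_iff_dvd]
      simp [coe_lowerUnipotent]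
    have hVG : lowerUnipotent (4 * M) ∈ G := by
      apply mem_transformSubgroup_of_dvd hp.pos hh <;> simp [coe_lowerUnipotent]
    refine (Subgroup.mul_mem_cancel_right G hVG).mp
      (key (Subgroup.mul_mem _ hγ hV) fun hdvd ↦ ?_)
    rw [h10, dvd_add_right hc, mul_dvd_mul_iff_left (by simpa using hM0)] at hdvd
    have hpc : (p : ℤ) ∣ γ 1 0 := (Dvd.intro_left _ rfl).trans hc
    exact hpZ.not_isUnit ((SL2Z_isCoprime γ).isUnit_of_dvd' hpc hdvd)
  · exact key hγ hc

/-! ### Fourier expansion and invariance under τ ↦ τ + 1. -/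

variable {L : ℕ}

lemma T_mem_Gamma1 (N : ℕ) : ModularGroup.T ∈ CongruenceSubgroup.Gamma1 N := by
  rw [mem_Gamma1_iff_dvd]
  simp [ModularGroup.coe_T]

lemma IsCuspForm.vadd_one (hh : IsCuspForm l L h) (τ : ℍ) : h ((1 : ℝ) +ᵥ τ) = h τ := by
  rw [← modular_T_smul, hh.transform _ (T_mem_Gamma1 _), thetaFactor_T, one_pow, one_mul]

lemma IsCuspForm.periodic_comp_ofComplex (hh : IsCuspForm l L h) :
    Function.Periodic (h ∘ ofComplex) ((1 : ℝ) : ℂ) := by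
  intro w
  by_cases! hw : 0 < w.im
  · have hw' : 0 < (w + (1 : ℝ)).im := by simpa using hw
    simp only [Function.comp_apply, ofComplex_apply_of_im_pos hw', ofComplex_apply_of_im_pos hw]
    rw [← hh.vadd_one ⟨w, hw⟩]
    congr 1
    ext
    simp [add_comm]
  · have hw' : (w + (1 : ℝ)).im ≤ 0 := by simpa using hw
    simp only [Function.comp_apply, ofComplex_apply_of_im_nonpos hw',
      ofComplex_apply_of_im_nonpos hw]

lemma IsCuspForm.isBoundedAtImInfty (hh : IsCuspForm l L h) : IsBoundedAtImInfty h := by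
  have := hh.zero_at_cusps 1
  simp only [one_smul, map_one, denom_one, one_cpow, one_mul] at this
  exact this.boundedAtFilter

lemma IsCuspForm.hasSum_fourierCoeff (hh : IsCuspForm l L h) (τ : ℍ) :
    HasSum (fun n : ℕ ↦ fourierCoeff h n * cexp (2 * Real.pi * I * n * τ)) (h τ) := by
  convert! hasSum_qExpansion one_pos hh.periodic_comp_ofComplex hh.holo hh.isBoundedAtImInfty τ
    using 2 with n
  rw [smul_eq_mul, Function.Periodic.qParam, ← Complex.exp_nat_mul, fourierCoeff]
  congr 2
  push_cast
  ring

lemma IsCuspForm.divNat_vadd_one (hh : IsCuspForm l L h) (hp : p.Prime)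
    (h_coeff : ∀ n : ℕ, n.Coprime p → fourierCoeff h n = 0) (τ : ℍ) :
    h (divNat p hp.pos ((1 : ℝ) +ᵥ τ)) = h (divNat p hp.pos τ) := by
  refine (hh.hasSum_fourierCoeff _).unique ?_
  convert! hh.hasSum_fourierCoeff (divNat p hp.pos τ) using 2 with n
  by_cases hn : n.Coprime p
  · rw [h_coeff n hn, zero_mul, zero_mul]
  · rw [Nat.coprime_comm, hp.coprime_iff_not_dvd, not_not] at hn
    obtain ⟨k, rfl⟩ := hn
    have hp0 : (p : ℂ) ≠ 0 := by exact_mod_cast hp.ne_zero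
    congr 1
    rw [coe_divNat, coe_divNat, coe_vadd,
      show (2 * Real.pi * I * (p * k : ℕ) * (((1 : ℝ) + τ) / p) : ℂ) =
        2 * Real.pi * I * (p * k : ℕ) * (τ / p) + k * (2 * Real.pi * I) by
          push_cast; field_simp; ring,
      Complex.exp_add, Complex.exp_nat_mul_two_pi_mul_I, mul_one]

/-! ### Holomorphy and vanishing at the cusps. -/

lemma mdifferentiable_comp_divNat (hp : 0 < p) (hh : MDifferentiable 𝓘(ℂ) 𝓘(ℂ) h) :
    MDifferentiable 𝓘(ℂ) 𝓘(ℂ) fun τ ↦ h (divNat p hp τ) := by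
  rw [UpperHalfPlane.mdifferentiable_iff] at hh ⊢
  have hmaps (z : ℂ) (hz : 0 < z.im) : 0 < (z / p).im := by
    rw [div_natCast_im]
    positivity
  have : DifferentiableOn ℂ (fun z : ℂ ↦ (h ∘ ofComplex) (z / p)) {z | 0 < z.im} :=
    hh.comp (by fun_prop) fun z hz ↦ hmaps z hz
  refine this.congr fun z hz ↦ ?_
  simp only [Function.comp_apply]
  rw [ofComplex_apply_of_im_pos hz, ofComplex_apply_of_im_pos (hmaps z hz)]
  rfl

/-- The equations say diag(1, p) γ = δ · (A, B; 0, D). The first column (a, pc) has gcd p or 1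
according to whether p divides a; divided by this gcd A, it becomes the first column of δ. -/
lemma exists_SL2Z_mul_upperTriangular (hp : p.Prime) (γ : SL(2, ℤ)) :
    ∃ (δ : SL(2, ℤ)) (A D : ℕ) (B : ℤ), 0 < A ∧ 0 < D ∧
      δ 0 0 * A = γ 0 0 ∧ δ 1 0 * A = p * γ 1 0 ∧
      δ 0 0 * B + δ 0 1 * D = γ 0 1 ∧ δ 1 0 * B + δ 1 1 * D = p * γ 1 1 := by
  have hdet := SL2Z_det γ
  by_cases hpa : (p : ℤ) ∣ γ 0 0
  · obtain ⟨a, ha⟩ := hpa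
    rw [ha] at hdet
    refine ⟨⟨!![a, γ 0 1; γ 1 0, p * γ 1 1], ?_⟩, p, 1, 0, hp.pos, one_pos, ?_, ?_, ?_, ?_⟩
    · rw [Matrix.det_fin_two]
      simp only [Matrix.of_apply, Matrix.cons_val', Matrix.cons_val_zero, Matrix.cons_val_one]
      linear_combination hdet
    · simp [ha, mul_comm]
    · simp [mul_comm]
    · simp
    · simp
  · have hco : IsCoprime (γ 0 0) (p * γ 1 0) := by
      refine IsCoprime.mul_right ?_ ⟨γ 1 1, -γ 0 1, by linear_combination hdet⟩
      exact ((Prime.coprime_iff_not_dvd (Nat.prime_iff_prime_int.mp hp)).mpr hpa).symm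
    obtain ⟨y, x, hxy⟩ := hco
    refine ⟨⟨!![γ 0 0, -x; p * γ 1 0, y], ?_⟩, 1, p, y * γ 0 1 + x * p * γ 1 1, one_pos, hp.pos,
      ?_, ?_, ?_, ?_⟩
    · rw [Matrix.det_fin_two]
      simp only [Matrix.of_apply, Matrix.cons_val', Matrix.cons_val_zero, Matrix.cons_val_one]
      linear_combination hxy
    · simp
    · simp
    · simp only [Matrix.of_apply, Matrix.cons_val', Matrix.cons_val_zero, Matrix.cons_val_one]
      linear_combination γ 0 1 * hxy + x * p * hdet
    · simp only [Matrix.of_apply, Matrix.cons_val', Matrix.cons_val_zero, Matrix.cons_val_one]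
      linear_combination p * γ 1 1 * hxy - y * p * hdet

/-- The point `(Aτ + B) / D` of the upper half plane. -/
noncomputable def affineMap {A D : ℕ} (hA : 0 < A) (hD : 0 < D) (B : ℤ) (τ : ℍ) : ℍ :=
  ⟨(A * τ + B) / D, by
    rw [div_natCast_im]
    have := τ.im_pos
    simpa using by positivity⟩

lemma tendsto_affineMap_atImInfty {A D : ℕ} (hA : 0 < A) (hD : 0 < D) (B : ℤ) :
    Tendsto (affineMap hA hD B) atImInfty atImInfty := by
  refine tendsto_comap_iff.mpr ?_
  have : UpperHalfPlane.im ∘ affineMap hA hD B = fun τ ↦ (A / D : ℝ) * τ.im := by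
    ext τ
    change (((A * τ + B) / D : ℂ)).im = _
    rw [div_natCast_im]
    simp
    ring
  rw [this]
  exact tendsto_comap.const_mul_atTop (by positivity)

lemma norm_cpow_neg_half (l : ℕ) {z : ℂ} (hz : z ≠ 0) :
    ‖z ^ (-((l : ℂ) / 2))‖ = ‖z‖ ^ (-((l : ℝ) / 2)) := by
  have : (-((l : ℂ) / 2)) = ((-((l : ℝ) / 2) : ℝ) : ℂ) := by push_cast; rfl
  rw [this, norm_cpow_of_ne_zero hz]
  simp

lemma IsCuspForm.divNat_zero_at_cusps (hh : IsCuspForm l L h) (hp : p.Prime) (γ : SL(2, ℤ)) :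
    IsZeroAtImInfty fun τ : ℍ ↦
      denom γ τ ^ (-((l : ℂ) / 2)) * h (divNat p hp.pos (γ • τ)) := by
  obtain ⟨δ, A, D, B, hA, hD, h00, h10, h01, h11⟩ := exists_SL2Z_mul_upperTriangular hp γ
  have hp0 : (p : ℂ) ≠ 0 := by exact_mod_cast hp.ne_zero
  have hD0 : (D : ℂ) ≠ 0 := by exact_mod_cast hD.ne'
  -- The automorphy factors of γ and δ differ by the constant D/p. Only norms are compared below, so
  -- the branch of the complex power plays no role.
  have hdenom (τ : ℍ) : denom γ τ = (D / p : ℝ) * denom δ (affineMap hA hD B τ) := by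
    have h10' : (δ 1 0 * A : ℂ) = p * γ 1 0 := by exact_mod_cast h10
    have h11' : (δ 1 0 * B + δ 1 1 * D : ℂ) = p * γ 1 1 := by exact_mod_cast h11
    rw [ModularGroup.denom_apply, ModularGroup.denom_apply,
      show (affineMap hA hD B τ : ℂ) = (A * τ + B) / D from rfl]
    push_cast
    field_simp
    linear_combination -τ * h10' - h11'
  have hsmul (τ : ℍ) : divNat p hp.pos (γ • τ) = δ • affineMap hA hD B τ := by
    have h00' : (δ 0 0 * A : ℂ) = γ 0 0 := by exact_mod_cast h00
    have h01' : (δ 0 0 * B + δ 0 1 * D : ℂ) = γ 0 1 := by exact_mod_cast h01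
    have h1 := hdenom τ
    rw [ModularGroup.denom_apply, ModularGroup.denom_apply] at h1
    have hγ0 := SL2Z_denom_ne_zero γ τ
    have hδ0 := SL2Z_denom_ne_zero δ (affineMap hA hD B τ)
    ext
    rw [coe_divNat, coe_SL2Z_smul, coe_SL2Z_smul, h1, ← h00', ← h01', div_div,
      div_eq_div_iff (by rw [← h1]; exact mul_ne_zero hγ0 hp0) hδ0,
      show (affineMap hA hD B τ : ℂ) = (A * τ + B) / D from rfl]
    push_cast
    field_simp
    ring
  have hlim := ((hh.zero_at_cusps δ).comp (tendsto_affineMap_atImInfty hA hD B)).norm.const_mul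
    ((D / p : ℝ) ^ (-((l : ℝ) / 2)))
  rw [norm_zero, mul_zero] at hlim
  refine tendsto_zero_iff_norm_tendsto_zero.mpr (hlim.congr fun τ ↦ ?_)
  have hδ0 := denom_ne_zero δ (affineMap hA hD B τ)
  simp only [Function.comp_apply]
  rw [norm_mul, norm_mul, norm_cpow_neg_half l (denom_ne_zero γ τ), norm_cpow_neg_half l hδ0, hsmul,
    hdenom, norm_mul, norm_real, Real.norm_of_nonneg (by positivity),
    Real.mul_rpow (by positivity) (norm_nonneg _), mul_assoc]

end Scaling

end HalfIntegralWeight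

theorem mainTheorem6 (l L p : ℕ) (hl : Odd l) (hL : 0 < L) (hp : p.Prime) (hp_odd : Odd p)
    (hpL : p ∣ L) (h : ℍ → ℂ) (hh : h ∈ HalfIntegralWeight.cuspForms l L) (h_ne : h ≠ 0)
    (h_coeff : ∀ n : ℕ, n.Coprime p → HalfIntegralWeight.fourierCoeff h n = 0) :
    (fun τ : ℍ ↦ h (HalfIntegralWeight.divNat p hp.pos τ)) ∈
      HalfIntegralWeight.cuspForms l (L / p) := by
  obtain ⟨M, rfl⟩ := hpL
  rw [Nat.mul_div_cancel_left M hp.pos]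
  replace hh : HalfIntegralWeight.IsCuspForm l (p * M) h := hh
  refine ⟨HalfIntegralWeight.mdifferentiable_comp_divNat hp.pos hh.holo, ?_,
    hh.divNat_zero_at_cusps hp⟩
  refine HalfIntegralWeight.Gamma1_le_transformSubgroup hp (Nat.pos_of_mul_pos_left hL)
    hh.transform fun τ ↦ ?_
  rw [HalfIntegralWeight.thetaFactor_T, one_pow, one_mul, UpperHalfPlane.modular_T_smul]
  exact hh.divNat_vadd_one hp h_coeff τ
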